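/- Identify a real gate on $n$ qubits with its matrix in the computational basis $\{|b\rangle : b\in\{0,1\}^n\}$, an element of the orthogonal group $O(2^n)$. A gate *preserves the computational basis* if it maps every $|b\rangle$ to some $\pm|b'\rangle$; otherwise it is *basis-changing*. For a gate $U$ on $r$ qubits and an ordered subset $A$ of $r$ of the $n$ qubits, $U[A]\in O(2^n)$ denotes $U$ applied to the qubits in $A$. On $n$ qubits, a set $G$ of real gates generates the subgroup of $O(2^n)$ generated by all $U[A]$ with $U\in G$ and $A$ an ordered subset of the qubits. The set $G$ is *complete* if for some $n\ge 1$ this subgroup is dense in $O(k)$, $k=2^n\ge2$. Let $\mathrm{CNOT}$ be the two-qubit gate $|a,b\rangle\mapsto|a,a\oplus b\rangle$. **Theorem.** Let $S$ be any single-qubit real gate such that $S^2$ is basis-changing. Then $\{\mathrm{CNOT},S\}$ is complete. More precisely, on two qubits $\{\mathrm{CNOT},S\}$ generates a dense subgroup of $O(4)$. -/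

import Mathlib

namespace RealCircuit

/-- The labels `b = b₁ b₂ ⋯ bₙ ∈ {0,1}ⁿ` of the computational basis vectors of `n` qubits. -/
abbrev Bits (n : ℕ) : Type := Fin n → Fin 2

/-- The real gates on `n` qubits, i.e. the orthogonal group `O(2ⁿ)`: a gate is given by its
matrix in the computational basis. Its topology is the subspace topology from real matrices. -/
abbrev RealGate (n : ℕ) : Type := Matrix.orthogonalGroup (Bits n) ℝ

/-- The computational basis vector `|b⟩`. -/
def ket {n : ℕ} (b : Bits n) : Bits n → ℝ := Pi.single b 1

/-- A real gate preserves the computational basis if it maps every computational basis vector to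
a computational basis vector up to a phase; for a real gate the phase is a sign. -/
def PreservesBasis {n : ℕ} (U : RealGate n) : Prop :=
  ∀ b : Bits n, ∃ b' : Bits n,
    U.1.mulVec (ket b) = ket b' ∨ U.1.mulVec (ket b) = -ket b'

/-- A gate is basis-changing if it does not preserve the computational basis. -/
def IsBasisChanging {n : ℕ} (U : RealGate n) : Prop := ¬ PreservesBasis U

/-- The matrix of CNOT, `|a, b⟩ ↦ |a, a ⊕ b⟩` (addition in `Fin 2` is addition modulo 2). -/
def cnotMatrix : Matrix (Bits 2) (Bits 2) ℝ :=
  Matrix.of fun x y => if x = ![y 0, y 0 + y 1] then 1 else 0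

theorem cnotMatrix_mem : cnotMatrix ∈ Matrix.orthogonalGroup (Bits 2) ℝ := by
  rw [Matrix.mem_orthogonalGroup_iff']
  ext x z
  have h : (![x 0, x 0 + x 1] : Bits 2) = ![z 0, z 0 + z 1] ↔ x = z := by
    revert x z; decide
  simp only [Matrix.mul_apply, Matrix.transpose_apply, cnotMatrix, Matrix.of_apply,
    ite_mul, one_mul, zero_mul, Finset.sum_ite_eq', Finset.mem_univ, if_true,
    Matrix.one_apply, h]

/-- The gate CNOT; qubit `0` is the control and qubit `1` is the target. -/
def CNOT : RealGate 2 := ⟨cnotMatrix, cnotMatrix_mem⟩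

/-- The matrix of `U[A]`: the `r`-qubit operator `U` acts on the qubits `A 0, …, A (r-1)` of an
`n`-qubit register (in this order), and the identity acts on all other qubits. -/
def applyMatrix {r n : ℕ} (U : Matrix (Bits r) (Bits r) ℝ) (A : Fin r ↪ Fin n) :
    Matrix (Bits n) (Bits n) ℝ :=
  open Classical in
  Matrix.of fun x y =>
    if ∀ i, i ∉ Set.range A → x i = y i then U (x ∘ A) (y ∘ A) else 0

theorem split_bijective {r n : ℕ} (A : Fin r ↪ Fin n) :
    Function.Bijective (fun x : Bits n =>
      ((x ∘ A, fun i => x i) : Bits r × ({i // i ∉ Set.range A} → Fin 2))) := by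
  classical
  constructor
  · intro x y h
    simp only [Prod.mk.injEq] at h
    funext i
    by_cases hi : i ∈ Set.range A
    · obtain ⟨j, rfl⟩ := hi
      exact congrFun h.1 j
    · exact congrFun h.2 ⟨i, hi⟩
  · rintro ⟨u, v⟩
    refine ⟨fun i => if hi : i ∈ Set.range A then u hi.choose else v ⟨i, hi⟩, ?_⟩
    refine Prod.ext ?_ ?_
    · funext j
      have hj : A j ∈ Set.range A := ⟨j, rfl⟩
      have : hj.choose = j := A.injective hj.choose_spec
      simp only [Function.comp_apply, dif_pos hj, this]
    · funext i
      simp only [dif_neg i.2]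

theorem applyMatrix_mem {r n : ℕ} (U : RealGate r) (A : Fin r ↪ Fin n) :
    applyMatrix U.1 A ∈ Matrix.orthogonalGroup (Bits n) ℝ := by
  classical
  let e := Equiv.ofBijective _ (split_bijective A)
  have key : applyMatrix U.1 A = (Matrix.kroneckerMap (· * ·) U.1
      (1 : Matrix ({i // i ∉ Set.range A} → Fin 2) _ ℝ)).submatrix e e := by
    ext x y
    have h : (∀ i, i ∉ Set.range A → x i = y i) ↔
        ((fun i : {i // i ∉ Set.range A} => x i) = fun i : {i // i ∉ Set.range A} => y i) := by
      rw [funext_iff, Subtype.forall]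
    simp only [applyMatrix, Matrix.of_apply, Matrix.submatrix_apply, Matrix.kroneckerMap_apply,
      e, Equiv.ofBijective_apply, Matrix.one_apply, mul_ite, mul_one, mul_zero, h]
  have hU : U.1 * U.1.transpose = 1 := (Matrix.mem_orthogonalGroup_iff _ _).1 U.2
  rw [Matrix.mem_orthogonalGroup_iff, key, Matrix.transpose_submatrix,
    Matrix.submatrix_mul_equiv, ← Matrix.kroneckerMap_transpose, ← Matrix.mul_kronecker_mul, hU]
  simp

/-- The gate `U[A]` on `n` qubits: `U` applied to the ordered subset `A` of the qubits. -/
def RealGate.applyTo {r n : ℕ} (U : RealGate r) (A : Fin r ↪ Fin n) : RealGate n :=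
  ⟨applyMatrix U.1 A, applyMatrix_mem U A⟩

/-- A real basis is a set of real gates, each with its own number of qubits. -/
abbrev RealBasis : Type := Set (Σ r : ℕ, RealGate r)

/-- The subgroup of `O(2ⁿ)` generated by a real basis on `n` qubits: it is generated by all
`U[A]`, where `U` is a gate of the basis and `A` is an ordered subset of the `n` qubits. -/
def generatedGroup (G : RealBasis) (n : ℕ) : Subgroup (RealGate n) :=
  Subgroup.closure {V | ∃ g ∈ G, ∃ A : Fin g.1 ↪ Fin n, V = g.2.applyTo A}

/-- On `n` qubits, the basis generates a dense subgroup of `O(2ⁿ)`. -/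
def GeneratesDense (G : RealBasis) (n : ℕ) : Prop :=
  Dense (generatedGroup G n : Set (RealGate n))

/-- A real basis is complete if it generates a dense subgroup of `O(k)` for some `k ≥ 2`, where
`k = 2ⁿ` is the dimension of the state space of `n ≥ 1` qubits. -/
def IsComplete (G : RealBasis) : Prop :=
  ∃ n : ℕ, 1 ≤ n ∧ GeneratesDense G n

end RealCircuit

namespace RealCircuit

open NormedSpace Filter Topology

/-! ### Roots of unity congruent to `1` modulo `4` -/

/-! Label the basis vectors `00, 01, 10, 11` by the quaternion units `1, i, j, k`. A reflection
squares to the identity, so `S` is a rotation by some `θ`, and `sin 4θ ≠ 0` because `S ^ 2` is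
basis-changing. On the second qubit `S` is left multiplication by `e^{iθ}`; conjugation by CNOTs
turns it into `e^{jθ}`. Let `K` consist of the quaternions whose left multiplication lies in the
closure of the generated group.

If `e^{iθ}` and `e^{iθ} e^{jθ}` both had finite order, `cos 2θ` would be an algebraic integer at a
rational angle, forcing `sin 4θ = 0` (`not_isOfFinOrder_or_mul`). So `K` contains an element of
infinite order, hence a whole circle (`im_mem_lieSet`). Its tangent, conjugated and combined
linearly, yields `i`, `j` and `k`, so `K` contains every unit quaternion (`mem_of_norm_eq_one`).

Unit quaternions act transitively on the sphere and CNOT is a hyperplane reflection, so the closure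
contains all hyperplane reflections, and these generate `O(4)` (`eq_top_of_leftMul_mem`). -/

theorem exists_one_add_pow_eq {R : Type*} [CommRing R] (x : R) (n : ℕ) :
    ∃ c, (1 + x) ^ n = 1 + n * x + x ^ 2 * c := by
  induction n with
  | zero => exact ⟨0, by simp⟩
  | succ n ih =>
    obtain ⟨c, hc⟩ := ih
    exact ⟨n + c + c * x, by rw [pow_succ, hc]; push_cast; ring⟩

/-- Modulus 4 is essential: `2 / 2` is integral, in accordance with the root of unity `-1 ≡ 1`
modulo 2. -/
theorem not_isIntegral_prime_div_four {p : ℕ} (hp : p.Prime) :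
    ¬ IsIntegral ℤ ((p : ℂ) / 4) := by
  intro h
  obtain ⟨k, hk⟩ := (IsIntegral.exists_int_iff_exists_rat h).1 ⟨(p : ℚ) / 4, by push_cast; rfl⟩
  have h4 : (p : ℤ) = 4 * k := by
    have : (p : ℂ) = 4 * k := by rw [← hk]; ring
    exact_mod_cast this
  have h4' : 2 * 2 ∣ p := by omega
  have h2 : p = 2 := ((Nat.prime_dvd_prime_iff_eq Nat.prime_two hp).1
    (dvd_trans (dvd_mul_right 2 2) h4')).symm
  omega

theorem eq_one_of_pow_prime_eq_one {p : ℕ} (hp : p.Prime) {b : ℂ} (hb : IsIntegral ℤ b)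
    (h : (1 + 4 * b) ^ p = 1) : b = 0 := by
  by_contra hb0
  obtain ⟨c, hc⟩ := exists_one_add_pow_eq
    (4 * (⟨b, hb⟩ : integralClosure ℤ ℂ)) p
  have hc' : (1 + 4 * b) ^ p = 1 + p * (4 * b) + (4 * b) ^ 2 * c := by
    exact congrArg Subtype.val hc
  rw [h] at hc'
  have h1 : (4 * b) * (p + 4 * b * c) = 0 := by linear_combination -hc'
  have h2 : (p : ℂ) / 4 = -(b * c) := by
    rcases mul_eq_zero.1 h1 with h1 | h1
    · exact absurd (by simpa using h1) hb0
    · linear_combination h1 / 4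
  exact not_isIntegral_prime_div_four hp (h2 ▸ (hb.mul c.2).neg)

/-- A nontrivial root of unity has a power of prime order, and powers stay congruent to 1 modulo 4.
-/
theorem eq_one_of_isOfFinOrder {b : ℂ} (hb : IsIntegral ℤ b)
    (h : IsOfFinOrder (1 + 4 * b)) : 1 + 4 * b = 1 := by
  by_contra h1
  have ho : orderOf (1 + 4 * b) ≠ 1 := fun h => h1 (orderOf_eq_one_iff.1 h)
  obtain ⟨p, hp, k, hk⟩ := Nat.exists_prime_and_dvd ho
  have hk0 : k ≠ 0 := by
    rintro rfl
    exact (orderOf_pos_iff.2 h).ne' (by simpa using hk)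
  have hd : ∃ b', IsIntegral ℤ b' ∧ (1 + 4 * b) ^ k = 1 + 4 * b' := by
    obtain ⟨c, hc⟩ := exists_one_add_pow_eq (4 * (⟨b, hb⟩ : integralClosure ℤ ℂ)) k
    have hc' : (1 + 4 * b) ^ k = 1 + k * (4 * b) + (4 * b) ^ 2 * c := by
      exact congrArg Subtype.val hc
    refine ⟨k * b + 4 * (b ^ 2 * c), ?_, by rw [hc']; ring⟩
    let β : integralClosure ℤ ℂ := ⟨b, hb⟩
    exact (k * β + 4 * (β ^ 2 * c)).2
  obtain ⟨b', hb', hkb⟩ := hd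
  have hb0 := eq_one_of_pow_prime_eq_one hp hb' (by
    rw [← hkb, ← pow_mul, mul_comm k, ← hk, pow_orderOf_eq_one])
  rw [hb0, mul_zero, add_zero] at hkb
  have := Nat.le_of_dvd (Nat.pos_of_ne_zero hk0) (orderOf_dvd_of_pow_eq_one hkb)
  rw [hk] at this
  nlinarith [hp.two_le, Nat.pos_of_ne_zero hk0]

/-- If the cosine of a rational multiple of `π` is an algebraic integer, then the angle is a
multiple of `π / 2`. -/
theorem sin_two_mul_eq_zero_of_isIntegral_cos {r : ℚ}
    (h : IsIntegral ℤ (Real.cos (r * Real.pi))) : Real.sin (2 * (r * Real.pi)) = 0 := by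
  set φ : ℝ := r * Real.pi with hφ
  set ζ : ℂ := Complex.exp (φ * Complex.I) with hζ
  have hζ' : ζ = Complex.exp (r * Real.pi * Complex.I) := by rw [hζ, hφ]; push_cast; rfl
  have hint : IsIntegral ℤ ζ := hζ' ▸ Complex.isIntegral_exp_rat_mul_pi_mul_I r
  have hcos : IsIntegral ℤ (Complex.cos φ) := by
    have := h.map (Algebra.ofId ℝ ℂ).toIntAlgHom
    simpa using this
  have hζ1 : ζ * Complex.exp (-(φ * Complex.I)) = 1 := by
    rw [hζ, ← Complex.exp_add]; simp
  have hζ2 : ζ ^ 2 = -1 + 2 * (Complex.cos φ * ζ) := by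
    rw [Complex.cos, neg_mul]
    linear_combination -hζ1
  have hfin : IsOfFinOrder ζ := by
    refine isOfFinOrder_iff_pow_eq_one.2 ⟨2 * r.den, by have := r.den_pos; omega, ?_⟩
    rw [hζ', ← Complex.exp_nat_mul, Complex.exp_eq_one_iff]
    refine ⟨r.num, ?_⟩
    have : (r.den : ℂ) * r = r.num := by exact_mod_cast Rat.den_mul_eq_num r
    push_cast
    linear_combination 2 * Real.pi * Complex.I * this
  -- Squaring `ζ² = -1 + 2 (cos φ) ζ` improves a congruence modulo 2 to one modulo 4.
  have h4 : ζ ^ 4 = 1 + 4 * ((Complex.cos φ * ζ) ^ 2 - Complex.cos φ * ζ) := by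
    rw [show ζ ^ 4 = (ζ ^ 2) ^ 2 by ring, hζ2]; ring
  have h41 : ζ ^ 4 = 1 := by
    rw [h4]
    refine eq_one_of_isOfFinOrder (((hcos.mul hint).pow 2).sub (hcos.mul hint)) ?_
    rw [← h4]
    exact hfin.pow
  rw [hζ, ← Complex.exp_nat_mul, Complex.exp_eq_one_iff] at h41
  obtain ⟨n, hn⟩ := h41
  have h2 : (2 * φ : ℝ) = n * Real.pi := by
    have h3 : (2 * φ : ℂ) * (2 * Complex.I) = (n * Real.pi) * (2 * Complex.I) := by
      push_cast at hn
      linear_combination hn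
    have := mul_right_cancel₀ (by simp) h3
    exact_mod_cast this
  rw [h2, Real.sin_int_mul_pi]

/-! ### Closed submonoids of the quaternions -/

open scoped Quaternion

theorem exp_smul_of_norm_eq_one {v : ℍ} (hv : v.re = 0) (hn : ‖v‖ = 1) (t : ℝ) :
    exp (t • v) = ↑(Real.cos t) + Real.sin t • v := by
  rw [Quaternion.exp_of_re_eq_zero (t • v) (by simp [hv]), norm_smul, hn, mul_one, Real.norm_eq_abs,
    Real.cos_abs, smul_smul]
  congr 2
  rcases eq_or_ne t 0 with rfl | ht
  · simp
  · rcases abs_choice t with h | h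
    · rw [h]; field_simp
    · rw [h, Real.sin_neg]; field_simp

theorem exp_add_smul (v : ℍ) (s t : ℝ) : exp ((s + t) • v) = exp (s • v) * exp (t • v) := by
  let +nondep : NormedAlgebra ℚ ℍ := .restrictScalars ℚ ℝ ℍ
  rw [add_smul, exp_add_of_commute]
  exact ((Commute.refl v).smul_left s).smul_right t

theorem norm_exp_of_re_eq_zero {v : ℍ} (hv : v.re = 0) : ‖exp v‖ = 1 := by
  rw [Quaternion.norm_exp, hv]; simp

theorem star_exp_of_re_eq_zero {v : ℍ} (hv : v.re = 0) : star (exp v) = exp (-v) := by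
  rw [star_exp, Quaternion.star_eq_neg.2 hv]

theorem norm_pow_sub_pow_le {a b : ℍ} (ha : ‖a‖ = 1) (hb : ‖b‖ = 1) (n : ℕ) :
    ‖a ^ n - b ^ n‖ ≤ n * ‖a - b‖ := by
  induction n with
  | zero => simp
  | succ n ih =>
    calc ‖a ^ (n + 1) - b ^ (n + 1)‖ = ‖a ^ n * (a - b) + (a ^ n - b ^ n) * b‖ := by
          congr 1; rw [pow_succ, pow_succ]; noncomm_ring
      _ ≤ ‖a ^ n * (a - b)‖ + ‖(a ^ n - b ^ n) * b‖ := norm_add_le _ _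
      _ = ‖a - b‖ + ‖a ^ n - b ^ n‖ := by simp [norm_mul, norm_pow, ha, hb]
      _ ≤ _ := by push_cast; linarith

theorem hasDerivAt_exp_smul_zero (v : ℍ) : HasDerivAt (fun t : ℝ => exp (t • v)) v 0 := by
  simpa using hasDerivAt_exp_smul_const (𝕂 := ℝ) v 0

/-- The exponential as a limit of powers along a curve of unit quaternions. -/
theorem tendsto_pow_exp {h : ℝ → ℍ} {u : ℍ} (hu : u.re = 0) (hn : ∀ t, ‖h t‖ = 1) (h0 : h 0 = 1)
    (hd : HasDerivAt h u 0) :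
    Tendsto (fun n : ℕ => h ((n + 1 : ℝ)⁻¹) ^ (n + 1)) atTop (𝓝 (exp u)) := by
  let +nondep : NormedAlgebra ℚ ℍ := .restrictScalars ℚ ℝ ℍ
  have hd' := (hd.sub (hasDerivAt_exp_smul_zero u)).tendsto_slope_zero_right
  have hlim : Tendsto (fun n : ℕ => (n + 1 : ℝ)⁻¹) atTop (𝓝[>] 0) := by
    refine tendsto_nhdsWithin_iff.2 ⟨?_, Eventually.of_forall fun n => ?_⟩
    · simpa using tendsto_one_div_add_atTop_nhds_zero_nat (𝕜 := ℝ)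
    · simp only [Set.mem_Ioi]; positivity
  have hd'' := (hd'.comp hlim).norm
  simp only [sub_self, norm_zero] at hd''
  rw [tendsto_iff_norm_sub_tendsto_zero]
  refine squeeze_zero (fun _ => norm_nonneg _) (fun n => ?_) hd''
  have he : exp u = exp ((n + 1 : ℝ)⁻¹ • u) ^ (n + 1) := by
    rw [← exp_nsmul, ← Nat.cast_smul_eq_nsmul ℝ, smul_smul]
    push_cast
    rw [mul_inv_cancel₀ (by positivity), one_smul]
  rw [he]
  refine (norm_pow_sub_pow_le (hn _) (norm_exp_of_re_eq_zero (by simp [hu])) _).trans ?_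
  simp only [Function.comp_apply, norm_smul, inv_inv, Pi.sub_apply, h0, zero_add, zero_smul,
    exp_zero, sub_self, sub_zero, Real.norm_eq_abs]
  rw [abs_of_pos (by positivity)]
  push_cast
  rfl

/-- The imaginary quaternions whose one-parameter subgroup lies in `K`. -/
def lieSet (K : Submonoid ℍ) : Set ℍ := {u | u.re = 0 ∧ ∀ t : ℝ, exp (t • u) ∈ K}

theorem smul_mem_lieSet {K : Submonoid ℍ} {u : ℍ} (hu : u ∈ lieSet K) (r : ℝ) :
    r • u ∈ lieSet K :=
  ⟨by simp [hu.1], fun t => by rw [smul_smul]; exact hu.2 _⟩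

/-- Lie product formula: `exp (u + v)` is the limit of `(exp (u/n) exp (v/n)) ^ n`. -/
theorem add_mem_lieSet {K : Submonoid ℍ} (hK : IsClosed (K : Set ℍ)) {u v : ℍ}
    (hu : u ∈ lieSet K) (hv : v ∈ lieSet K) : u + v ∈ lieSet K := by
  have key : ∀ {u v : ℍ}, u ∈ lieSet K → v ∈ lieSet K → exp (u + v) ∈ K := by
    intro u v hu hv
    have hd := (hasDerivAt_exp_smul_zero u).mul (hasDerivAt_exp_smul_zero v)
    simp only [zero_smul, exp_zero, mul_one, one_mul] at hd
    refine hK.mem_of_tendsto (tendsto_pow_exp (h := fun t => exp (t • u) * exp (t • v))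
      (by simp [hu.1, hv.1]) (fun t => ?_) (by simp) hd) (Eventually.of_forall fun n => ?_)
    · rw [norm_mul, norm_exp_of_re_eq_zero (by simp [hu.1]),
        norm_exp_of_re_eq_zero (by simp [hv.1]), mul_one]
    · exact K.pow_mem (K.mul_mem (hu.2 _) (hv.2 _)) _
  refine ⟨by simp [hu.1, hv.1], fun t => ?_⟩
  rw [smul_add]
  exact key (smul_mem_lieSet hu t) (smul_mem_lieSet hv t)

theorem conj_mem_lieSet {K : Submonoid ℍ} {u g : ℍ} (hu : u ∈ lieSet K) (hg : g ∈ K)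
    (hg' : star g ∈ K) (hn : ‖g‖ = 1) : g * u * star g ∈ lieSet K := by
  let +nondep : NormedAlgebra ℚ ℍ := .restrictScalars ℚ ℝ ℍ
  have hs : star g = g⁻¹ := by
    rw [Quaternion.instInv]; simp [Quaternion.normSq_eq_norm_mul_self, hn]
  refine ⟨?_, fun t => ?_⟩
  · have := hu.1
    simp [this]
    ring
  · have hg0 : g ≠ 0 := fun h => by simp [h] at hn
    rw [← smul_mul_assoc, ← mul_smul_comm, hs, exp_conj _ _ hg0, ← hs]
    exact K.mul_mem (K.mul_mem hg (hu.2 t)) hg'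

/-- The quaternion `a + b i + c j + d k`. -/
def quat (a b c d : ℝ) : ℍ := ⟨a, b, c, d⟩

section quat

variable (a b c d : ℝ)

@[simp] theorem re_quat : (quat a b c d).re = a := rfl

@[simp] theorem imI_quat : (quat a b c d).imI = b := rfl

@[simp] theorem imJ_quat : (quat a b c d).imJ = c := rfl

@[simp] theorem imK_quat : (quat a b c d).imK = d := rfl

end quat

/-! ### Polar form and unit quaternions of finite order -/

theorem norm_sq_eq_sum_sq (q : ℍ) :
    ‖q‖ ^ 2 = q.re ^ 2 + q.imI ^ 2 + q.imJ ^ 2 + q.imK ^ 2 := by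
  rw [sq, ← Quaternion.normSq_eq_norm_mul_self, Quaternion.normSq_def']

theorem norm_eq_one_iff_sum_sq {q : ℍ} :
    ‖q‖ = 1 ↔ q.re ^ 2 + q.imI ^ 2 + q.imJ ^ 2 + q.imK ^ 2 = 1 := by
  rw [← norm_sq_eq_sum_sq, pow_eq_one_iff_of_nonneg (norm_nonneg q) two_ne_zero]

theorem exists_polar {q : ℍ} (hq : ‖q‖ = 1) : ∃ (ψ : ℝ) (v : ℍ), v.re = 0 ∧ ‖v‖ = 1 ∧
    q = exp (ψ • v) ∧ Real.cos ψ = q.re ∧ q.im = Real.sin ψ • v := by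
  have hs : q.re ^ 2 + ‖q.im‖ ^ 2 = 1 := by
    have := norm_eq_one_iff_sum_sq.1 hq
    rw [norm_sq_eq_sum_sq]
    simp
    linarith
  have hc : Real.cos (Real.arccos q.re) = q.re :=
    Real.cos_arccos (by nlinarith [sq_nonneg ‖q.im‖]) (by nlinarith [sq_nonneg ‖q.im‖])
  have hsin : Real.sin (Real.arccos q.re) = ‖q.im‖ := by
    have h1 : 1 - q.re ^ 2 = ‖q.im‖ ^ 2 := by linarith
    rw [Real.sin_arccos, h1, Real.sqrt_sq (norm_nonneg _)]
  obtain ⟨v, hv, hv1, hv2⟩ : ∃ v : ℍ, v.re = 0 ∧ ‖v‖ = 1 ∧ q.im = ‖q.im‖ • v := by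
    rcases eq_or_ne q.im 0 with h | h
    -- For `q = ±1` the axis is arbitrary; `i` is taken.
    · exact ⟨quat 0 1 0 0, rfl, norm_eq_one_iff_sum_sq.2 (by simp), by rw [h, norm_zero, zero_smul]⟩
    · have h' := norm_ne_zero_iff.2 h
      refine ⟨‖q.im‖⁻¹ • q.im, by simp, ?_, ?_⟩
      · rw [norm_smul, norm_inv, norm_norm, inv_mul_cancel₀ h']
      · rw [smul_smul, mul_inv_cancel₀ h', one_smul]
  refine ⟨Real.arccos q.re, v, hv, hv1, ?_, hc, by rw [hsin, ← hv2]⟩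
  rw [exp_smul_of_norm_eq_one hv hv1, hc, hsin, ← hv2, Quaternion.re_add_im]

theorem exp_smul_pow (v : ℍ) (t : ℝ) (n : ℕ) : exp (t • v) ^ n = exp ((n * t) • v) := by
  let +nondep : NormedAlgebra ℚ ℍ := .restrictScalars ℚ ℝ ℍ
  rw [← exp_nsmul, ← Nat.cast_smul_eq_nsmul ℝ, smul_smul]

theorem re_exp_smul {v : ℍ} (hv : v.re = 0) (hn : ‖v‖ = 1) (t : ℝ) :
    (exp (t • v)).re = Real.cos t := by
  rw [exp_smul_of_norm_eq_one hv hn]; simp [hv]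

/-- An angle `ψ` for which `exp (ψ v)` has finite order is a rational multiple of `π`. -/
theorem exists_eq_rat_mul_pi {v : ℍ} (hv : v.re = 0) (hn : ‖v‖ = 1) {ψ : ℝ}
    (h : IsOfFinOrder (exp (ψ • v))) : ∃ r : ℚ, ψ = r * Real.pi := by
  obtain ⟨n, hn0, hpow⟩ := isOfFinOrder_iff_pow_eq_one.1 h
  rw [exp_smul_pow] at hpow
  have hre := congrArg (fun q : ℍ => q.re) hpow
  simp only [re_exp_smul hv hn, Quaternion.re_one] at hre
  obtain ⟨k, hk⟩ := (Real.cos_eq_one_iff _).1 hre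
  refine ⟨2 * k / n, ?_⟩
  have : (n : ℝ) ≠ 0 := by positivity
  push_cast
  field_simp
  linarith

theorem isIntegral_two_mul_re {q : ℍ} (hq : ‖q‖ = 1) (h : IsOfFinOrder q) :
    IsIntegral ℤ (2 * q.re) := by
  obtain ⟨ψ, v, hv, hn, rfl, hc, -⟩ := exists_polar hq
  obtain ⟨r, rfl⟩ := exists_eq_rat_mul_pi hv hn h
  rw [← hc]
  exact Real.isIntegral_two_mul_cos_rat_mul_pi r

/-- A closed submonoid containing a unit quaternion of infinite order contains the circle through
this quaternion. -/
theorem im_mem_lieSet {K : Submonoid ℍ} (hK : IsClosed (K : Set ℍ))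
    (hstar : ∀ q ∈ K, star q ∈ K) {q : ℍ} (hqK : q ∈ K) (hq : ‖q‖ = 1)
    (hfin : ¬ IsOfFinOrder q) : q.im ∈ lieSet K := by
  obtain ⟨ψ, v, hv, hn, hexp, -, him⟩ := exists_polar hq
  rw [him]
  refine smul_mem_lieSet ⟨hv, ?_⟩ _
  -- The times at which the one-parameter group lies in `K` form a closed subgroup of `ℝ`, which is
  -- therefore everything or cyclic.
  let A : AddSubgroup ℝ :=
    { carrier := {t | exp (t • v) ∈ K}
      add_mem' := fun {s t} hs ht => by
        change exp ((s + t) • v) ∈ K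
        rw [exp_add_smul]; exact K.mul_mem hs ht
      zero_mem' := by simp [K.one_mem]
      neg_mem' := fun {t} ht => by
        change exp ((-t) • v) ∈ K
        rw [neg_smul, ← star_exp_of_re_eq_zero (by simp [hv])]
        exact hstar _ ht }
  have hA : IsClosed (A : Set ℝ) := by
    let +nondep : NormedAlgebra ℚ ℍ := .restrictScalars ℚ ℝ ℍ
    exact hK.preimage (exp_continuous.comp (continuous_id.smul continuous_const))
  have hexp2 : exp ((2 * Real.pi) • v) = 1 := by
    rw [exp_smul_of_norm_eq_one hv hn]; simp
  have h2 : 2 * Real.pi ∈ A := by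
    change exp ((2 * Real.pi) • v) ∈ K
    rw [hexp2]; exact K.one_mem
  have hψ : ψ ∈ A := by
    change exp (ψ • v) ∈ K
    rwa [← hexp]
  rcases A.dense_or_cyclic with hd | ⟨a, ha⟩
  · intro t
    have : t ∈ (A : Set ℝ) := by rw [← hA.closure_eq, hd.closure_eq]; trivial
    exact this
  · exfalso
    -- In the cyclic case `2π = m a` and `ψ = n a`, so `m ψ = n (2π)` and `q` has finite order.
    rw [ha, AddSubgroup.mem_closure_singleton] at h2 hψ
    obtain ⟨m, hm⟩ := h2
    obtain ⟨n, hn'⟩ := hψ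
    rw [zsmul_eq_mul] at hm hn'
    have hm0 : m ≠ 0 := by
      rintro rfl
      simp at hm
    apply hfin
    refine isOfFinOrder_iff_pow_eq_one.2 ⟨m.natAbs, Int.natAbs_pos.2 hm0, ?_⟩
    rw [hexp, exp_smul_pow, exp_smul_of_norm_eq_one hv hn]
    obtain ⟨l, hl⟩ : ∃ l : ℤ, (m.natAbs : ℝ) * ψ = l * (2 * Real.pi) := by
      rcases Int.natAbs_eq m with h | h
      · refine ⟨n, ?_⟩
        have h' : ((m.natAbs : ℝ)) = m := by
          have : (m.natAbs : ℤ) = m := h.symm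
          exact congrArg (Int.cast (R := ℝ)) this
        rw [h', ← hm, ← hn']; ring
      · refine ⟨-n, ?_⟩
        have h' : ((m.natAbs : ℝ)) = -m := by
          have : (m.natAbs : ℤ) = -m := by omega
          simpa using congrArg (Int.cast (R := ℝ)) this
        rw [h', ← hm, ← hn']; push_cast; ring
    rw [hl, Real.cos_int_mul_two_pi, show (l : ℝ) * (2 * Real.pi) = (2 * l : ℤ) * Real.pi by
      push_cast; ring, Real.sin_int_mul_pi]
    simp

/-- The product has real part `cos² θ`. If its order is finite, `2 cos² θ` is an algebraic integer,
and so is `cos 2θ = 2 cos² θ - 1`. -/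
theorem not_isOfFinOrder_or_mul {θ : ℝ} (hθ : Real.sin (4 * θ) ≠ 0) :
    ¬ IsOfFinOrder (quat (Real.cos θ) (Real.sin θ) 0 0) ∨
    ¬ IsOfFinOrder (quat (Real.cos θ) (Real.sin θ) 0 0 * quat (Real.cos θ) 0 (Real.sin θ) 0) := by
  by_contra! h
  obtain ⟨h1, h2⟩ := h
  have hcs := Real.cos_sq_add_sin_sq θ
  have hI : quat (Real.cos θ) (Real.sin θ) 0 0 = exp (θ • quat 0 1 0 0) := by
    rw [exp_smul_of_norm_eq_one (re_quat _ _ _ _) (norm_eq_one_iff_sum_sq.2 (by simp))]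
    ext <;> simp
  rw [hI] at h1
  obtain ⟨r, hr⟩ := exists_eq_rat_mul_pi (re_quat _ _ _ _) (norm_eq_one_iff_sum_sq.2 (by simp)) h1
  have h3 := isIntegral_two_mul_re (by
    rw [norm_mul, norm_eq_one_iff_sum_sq.2, norm_eq_one_iff_sum_sq.2, mul_one] <;>
      simp [hcs]) h2
  have h4 : IsIntegral ℤ (Real.cos ((2 * r : ℚ) * Real.pi)) := by
    have h5 := h3.sub (isIntegral_one (R := ℤ) (B := ℝ))
    have h6 : Real.cos ((2 * r : ℚ) * Real.pi) = 2 * Real.cos θ ^ 2 - 1 := by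
      rw [← Real.cos_two_mul, hr]; push_cast; ring_nf
    have h7 : (quat (Real.cos θ) (Real.sin θ) 0 0 * quat (Real.cos θ) 0 (Real.sin θ) 0).re =
        Real.cos θ ^ 2 := by
      simp
      ring
    rwa [h6, ← h7]
  apply hθ
  rw [← sin_two_mul_eq_zero_of_isIntegral_cos h4, hr]
  push_cast
  ring_nf

/-- A closed star-invariant submonoid of the quaternions containing `exp (θ i)` and `exp (θ j)`,
where `θ` is not a multiple of `π / 4`, contains all unit quaternions. -/
theorem mem_of_norm_eq_one {K : Submonoid ℍ} (hK : IsClosed (K : Set ℍ))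
    (hstar : ∀ q ∈ K, star q ∈ K) {θ : ℝ} (hθ : Real.sin (4 * θ) ≠ 0)
    (hI : quat (Real.cos θ) (Real.sin θ) 0 0 ∈ K) (hJ : quat (Real.cos θ) 0 (Real.sin θ) 0 ∈ K)
    {q : ℍ} (hq : ‖q‖ = 1) : q ∈ K := by
  have hcs := Real.cos_sq_add_sin_sq θ
  have hI1 : ‖quat (Real.cos θ) (Real.sin θ) 0 0‖ = 1 := norm_eq_one_iff_sum_sq.2 (by simp)
  have hJ1 : ‖quat (Real.cos θ) 0 (Real.sin θ) 0‖ = 1 := norm_eq_one_iff_sum_sq.2 (by simp)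
  have h4 : Real.sin (4 * θ) =
      4 * Real.sin θ * Real.cos θ * (Real.cos θ ^ 2 - Real.sin θ ^ 2) := by
    rw [show 4 * θ = 2 * (2 * θ) by ring, Real.sin_two_mul, Real.sin_two_mul, Real.cos_two_mul']
    ring
  have hs0 : Real.sin θ ≠ 0 := fun h => hθ (by rw [h4, h]; ring)
  have hc0 : Real.cos θ ≠ 0 := fun h => hθ (by rw [h4, h]; ring)
  have hIs : star (quat (Real.cos θ) (Real.sin θ) 0 0) = quat (Real.cos θ) (-Real.sin θ) 0 0 := by
    ext <;> simp
  have hJs : star (quat (Real.cos θ) 0 (Real.sin θ) 0) = quat (Real.cos θ) 0 (-Real.sin θ) 0 := by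
    ext <;> simp
  have hconjI := fun {u : ℍ} (hu : u ∈ lieSet K) => conj_mem_lieSet hu hI (hstar _ hI) hI1
  have hconjI' := fun {u : ℍ} (hu : u ∈ lieSet K) =>
    conj_mem_lieSet hu (hstar _ hI) (by rwa [star_star]) (by rwa [norm_star])
  have hconjJ := fun {u : ℍ} (hu : u ∈ lieSet K) => conj_mem_lieSet hu hJ (hstar _ hJ) hJ1
  simp only [hIs, hJs] at hconjI hconjI' hconjJ
  have hu : ∃ u ∈ lieSet K, u.imI ≠ 0 := by
    rcases not_isOfFinOrder_or_mul hθ with h | h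
    · exact ⟨_, im_mem_lieSet hK hstar hI hI1 h, by simpa using hs0⟩
    · refine ⟨_, im_mem_lieSet hK hstar (K.mul_mem hI hJ) (by rw [norm_mul, hI1, hJ1, one_mul]) h, ?_⟩
      simpa using ⟨hs0, hc0⟩
  generalize Real.cos θ = c at *
  generalize Real.sin θ = s at *
  obtain ⟨u, hu, hui⟩ := hu
  -- Conjugation by `e^{±iθ}` fixes `i` and rotates the `j, k` plane by `±2θ`. The sum of both
  -- conjugates minus `2 cos 2θ • u` kills that plane and leaves `4 sin² θ` times the `i`-part.
  have hi : quat 0 1 0 0 ∈ lieSet K := by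
    have h := smul_mem_lieSet (add_mem_lieSet hK (add_mem_lieSet hK (hconjI hu) (hconjI' hu))
      (smul_mem_lieSet hu (-2 * (c ^ 2 - s ^ 2)))) (4 * s ^ 2 * u.imI)⁻¹
    refine Set.mem_of_eq_of_mem ?_ h
    have := hu.1
    have hne : 4 * s ^ 2 * u.imI ≠ 0 := by positivity
    ext <;> simp [this] <;> field_simp <;> ring_nf
  -- Conjugating `i` by `e^{jθ}` gives `cos 2θ i - sin 2θ k`; likewise `k` then yields `j`.
  have hk : quat 0 0 0 1 ∈ lieSet K := by
    have h := smul_mem_lieSet (add_mem_lieSet hK (hconjJ hi)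
      (smul_mem_lieSet hi (-(c ^ 2 - s ^ 2)))) (-2 * s * c)⁻¹
    refine Set.mem_of_eq_of_mem ?_ h
    ext <;> simp <;> field_simp <;> ring
  have hj : quat 0 0 1 0 ∈ lieSet K := by
    have h := smul_mem_lieSet (add_mem_lieSet hK (hconjI hk)
      (smul_mem_lieSet hk (-(c ^ 2 - s ^ 2)))) (-2 * s * c)⁻¹
    refine Set.mem_of_eq_of_mem ?_ h
    ext <;> simp <;> field_simp <;> ring
  obtain ⟨ψ, v, hv, -, rfl, -, -⟩ := exists_polar hq
  have hv' : v ∈ lieSet K := by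
    refine Set.mem_of_eq_of_mem ?_ (add_mem_lieSet hK (add_mem_lieSet hK
      (smul_mem_lieSet hi v.imI) (smul_mem_lieSet hj v.imJ)) (smul_mem_lieSet hk v.imK))
    ext <;> simp [hv]
  exact hv'.2 ψ

end RealCircuit

namespace RealCircuit

open Matrix

open scoped Quaternion RealInnerProductSpace

/-! ### Two-qubit states as quaternions -/

theorem forall_bits_two {p : Bits 2 → Prop} :
    (∀ x, p x) ↔ p ![0, 0] ∧ p ![0, 1] ∧ p ![1, 0] ∧ p ![1, 1] := by
  refine ⟨fun h => ⟨h _, h _, h _, h _⟩, fun h x => ?_⟩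
  have : x = ![0, 0] ∨ x = ![0, 1] ∨ x = ![1, 0] ∨ x = ![1, 1] := by revert x; decide
  rcases this with rfl | rfl | rfl | rfl <;> tauto

theorem sum_bits_two {M : Type*} [AddCommMonoid M] (f : Bits 2 → M) :
    ∑ x, f x = f ![0, 0] + f ![0, 1] + f ![1, 0] + f ![1, 1] := by
  rw [← (piFinTwoEquiv fun _ => Fin 2).symm.sum_comp, Fintype.sum_prod_type]
  simp only [Fin.sum_univ_two, ← add_assoc]
  rfl

/-- The real coordinates of a quaternion, with `1, i, j, k` labelled by `00, 01, 10, 11`. -/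
def quatCoord (q : ℍ) (x : Bits 2) : ℝ := !![q.re, q.imI; q.imJ, q.imK] (x 0) (x 1)

/-- The quaternion units `1, i, j, k`, labelled by `00, 01, 10, 11`. -/
noncomputable def quatUnit (x : Bits 2) : ℍ :=
  !![quat 1 0 0 0, quat 0 1 0 0; quat 0 0 1 0, quat 0 0 0 1] (x 0) (x 1)

/-- The matrix of left multiplication by a quaternion. -/
noncomputable def leftMul (q : ℍ) : Matrix (Bits 2) (Bits 2) ℝ :=
  of fun x y => quatCoord (q * quatUnit y) x

theorem leftMul_one : leftMul 1 = 1 := by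
  ext x y
  revert x y
  simp only [forall_bits_two]
  simp [leftMul, quatCoord, quatUnit, one_apply]

theorem leftMul_mul (p q : ℍ) : leftMul (p * q) = leftMul p * leftMul q := by
  ext x y
  rw [mul_apply, sum_bits_two]
  revert x y
  simp only [forall_bits_two]
  simp [leftMul, quatCoord, quatUnit]
  refine ⟨⟨?_, ?_, ?_, ?_⟩, ⟨?_, ?_, ?_, ?_⟩, ⟨?_, ?_, ?_, ?_⟩, ?_, ?_, ?_, ?_⟩ <;> ring

theorem leftMul_star (q : ℍ) : leftMul (star q) = (leftMul q)ᵀ := by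
  ext x y
  revert x y
  simp only [forall_bits_two]
  simp [leftMul, quatCoord, quatUnit]

theorem leftMul_mulVec_quatCoord (p q : ℍ) :
    leftMul p *ᵥ quatCoord q = quatCoord (p * q) := by
  ext x
  rw [mulVec, dotProduct, sum_bits_two]
  revert x
  simp only [forall_bits_two]
  simp [leftMul, quatCoord, quatUnit]
  refine ⟨?_, ?_, ?_, ?_⟩ <;> ring

theorem quatCoord_smul (r : ℝ) (q : ℍ) : quatCoord (r • q) = r • quatCoord q := by
  ext x
  revert x
  simp only [forall_bits_two]
  simp [quatCoord]

theorem quatCoord_add (p q : ℍ) : quatCoord (p + q) = quatCoord p + quatCoord q := by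
  ext x
  revert x
  simp only [forall_bits_two]
  simp [quatCoord]

theorem quatCoord_surjective : Function.Surjective quatCoord := fun f =>
  ⟨quat (f ![0, 0]) (f ![0, 1]) (f ![1, 0]) (f ![1, 1]), by
    ext x
    revert x
    simp only [forall_bits_two]
    simp [quatCoord]⟩

theorem continuous_leftMul : Continuous leftMul := by
  let L : ℍ →ₗ[ℝ] Matrix (Bits 2) (Bits 2) ℝ :=
    { toFun := leftMul
      map_add' := fun p q => by
        ext x y
        simp [leftMul, add_mul, quatCoord_add]
      map_smul' := fun r q => by
        ext x y
        simp [leftMul, quatCoord_smul] }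
  exact L.continuous_of_finiteDimensional

/-! ### The gates as matrices -/

/-- The matrix `|y⟩ ↦ |f y⟩`. -/
def mapMatrix (f : Bits 2 → Bits 2) : Matrix (Bits 2) (Bits 2) ℝ :=
  of fun x y => if x = f y then 1 else 0

theorem mul_mapMatrix (M : Matrix (Bits 2) (Bits 2) ℝ) (f : Bits 2 → Bits 2) :
    M * mapMatrix f = of fun x y => M x (f y) := by
  ext x y
  simp [mul_apply, mapMatrix]

theorem mapMatrix_mul (M : Matrix (Bits 2) (Bits 2) ℝ) {f : Bits 2 → Bits 2}
    (hf : Function.Involutive f) : mapMatrix f * M = of fun x y => M (f x) y := by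
  ext x y
  have : ∀ z, x = f z ↔ f x = z := fun z => ⟨fun h => by rw [h, hf], fun h => by rw [← h, hf]⟩
  simp [mul_apply, mapMatrix, this]

/-- The bits after a CNOT whose control is qubit `0`. -/
def flipOne (y : Bits 2) : Bits 2 := ![y 0, y 0 + y 1]

/-- The bits after a CNOT whose control is qubit `1`. -/
def flipZero (y : Bits 2) : Bits 2 := ![y 0 + y 1, y 1]

theorem flipOne_involutive : Function.Involutive flipOne := by
  intro x
  revert x
  unfold flipOne
  decide

theorem flipZero_involutive : Function.Involutive flipZero := by
  intro x
  revert x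
  unfold flipZero
  decide

theorem CNOT_applyTo_refl :
    (RealGate.applyTo CNOT (Function.Embedding.refl (Fin 2))).1 = mapMatrix flipOne := by
  ext x y
  simp [RealGate.applyTo, applyMatrix, CNOT, cnotMatrix, mapMatrix, flipOne]
  rfl

theorem CNOT_applyTo_swap :
    (RealGate.applyTo CNOT (Equiv.swap (0 : Fin 2) 1).toEmbedding).1 = mapMatrix flipZero := by
  ext x y
  have h : (x ∘ Equiv.swap (0 : Fin 2) 1 = ![y 1, y 1 + y 0]) ↔ x = flipZero y := by
    revert x y; unfold flipZero; decide
  simp [RealGate.applyTo, applyMatrix, CNOT, cnotMatrix, mapMatrix, h]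

theorem forall_bits_one {p : Bits 1 → Prop} : (∀ x, p x) ↔ p ![0] ∧ p ![1] := by
  refine ⟨fun h => ⟨h _, h _⟩, fun h x => ?_⟩
  have : x = ![0] ∨ x = ![1] := by revert x; decide
  rcases this with rfl | rfl <;> tauto

theorem sum_bits_one {M : Type*} [AddCommMonoid M] (f : Bits 1 → M) :
    ∑ x, f x = f ![0] + f ![1] := by
  rw [← (Equiv.funUnique (Fin 1) (Fin 2)).symm.sum_comp]
  simp only [Fin.sum_univ_two]
  congr 2 <;> (ext i; fin_cases i; rfl)

/-- The matrix of a single-qubit rotation. -/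
def rotation (c s : ℝ) : Matrix (Bits 1) (Bits 1) ℝ := of fun x y => !![c, -s; s, c] (x 0) (y 0)

/-- Since `i * 1 = i` and `i * j = k`, left multiplication by `c + s i` rotates the planes `1, i`
and `j, k` alike, as a rotation of the second qubit does. -/
theorem rotation_applyTo {S : RealGate 1} {c s : ℝ} (hS : S.1 = rotation c s)
    {A : Fin 1 ↪ Fin 2} (hA : A 0 = 1) :
    (RealGate.applyTo S A).1 = leftMul (quat c s 0 0) := by
  ext x y
  have h : (∀ i, i ∉ Set.range A → x i = y i) ↔ x 0 = y 0 := by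
    simp [Fin.forall_fin_two, hA]
  simp only [RealGate.applyTo, applyMatrix, hS, of_apply, h, rotation, Function.comp_apply, hA]
  revert x y
  simp only [forall_bits_two]
  simp [leftMul, quatCoord, quatUnit]

/-- The two CNOTs swap `i, k` and `j, k`; together they form the automorphism `i → j → k → i` of the
quaternions. -/
theorem conj_leftMul (c s : ℝ) :
    mapMatrix flipOne * (mapMatrix flipZero * leftMul (quat c s 0 0) * mapMatrix flipZero) *
      mapMatrix flipOne = leftMul (quat c 0 s 0) := by
  rw [mapMatrix_mul _ flipZero_involutive, mapMatrix_mul _ flipOne_involutive, mul_mapMatrix,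
    mul_mapMatrix]
  ext x y
  revert x y
  simp only [forall_bits_two]
  simp [leftMul, quatCoord, quatUnit, flipOne, flipZero]

/-- A single-qubit gate whose square is basis-changing is a rotation by an angle that is not a
multiple of `π / 4`. -/
theorem exists_eq_rotation {S : RealGate 1} (hS : IsBasisChanging (S ^ 2)) :
    ∃ θ : ℝ, S.1 = rotation (Real.cos θ) (Real.sin θ) ∧ Real.sin (4 * θ) ≠ 0 := by
  obtain ⟨a, ha⟩ : ∃ a, S.1 ![0] ![0] = a := ⟨_, rfl⟩
  obtain ⟨b, hb⟩ : ∃ b, S.1 ![0] ![1] = b := ⟨_, rfl⟩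
  obtain ⟨c, hc⟩ : ∃ c, S.1 ![1] ![0] = c := ⟨_, rfl⟩
  obtain ⟨d, hd⟩ : ∃ d, S.1 ![1] ![1] = d := ⟨_, rfl⟩
  have h1 := (mem_orthogonalGroup_iff _ _).1 S.2
  have h2 := (mem_orthogonalGroup_iff' _ _).1 S.2
  rw [← ext_iff] at h1 h2
  simp only [forall_bits_one, mul_apply, sum_bits_one, transpose_apply, one_apply, ha, hb, hc, hd]
    at h1 h2
  simp at h1 h2
  obtain ⟨⟨h11, h12⟩, -, h14⟩ := h1
  obtain ⟨⟨h21, h22⟩, -, h24⟩ := h2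
  have hsq : ∀ x y, (S ^ 2).1 x y = S.1 x ![0] * S.1 ![0] y + S.1 x ![1] * S.1 ![1] y := by
    intro x y
    rw [pow_two, ← sum_bits_one fun z => S.1 x z * S.1 z y]
    rfl
  -- The two alternatives are determinant `1` (rotation) and `-1` (reflection).
  have hcd : (d = a ∧ b = -c) ∨ (d = -a ∧ b = c) := by
    have hbc : (b - c) * (b + c) = 0 := by linear_combination h11 - h21
    have had : (d - a) * (d + a) = 0 := by linear_combination h14 - h21
    rcases eq_or_ne c 0 with rfl | hc0
    · have hb0 : b = 0 := by simpa using hbc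
      rcases mul_eq_zero.1 had with h | h
      · exact Or.inl ⟨by linarith, by simp [hb0]⟩
      · exact Or.inr ⟨by linarith, hb0⟩
    · rcases mul_eq_zero.1 hbc with h | h
      · refine Or.inr ⟨mul_left_cancel₀ hc0 ?_, by linarith⟩
        linear_combination h12 - d * h
      · refine Or.inl ⟨mul_left_cancel₀ hc0 ?_, by linarith⟩
        linear_combination -h12 + d * h
  unfold IsBasisChanging PreservesBasis at hS
  simp only [ket, mulVec_single_one, forall_bits_one, funext_iff, col_apply, hsq, ha, hb, hc, hd]
    at hS
  rcases hcd with ⟨rfl, rfl⟩ | ⟨rfl, rfl⟩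
  · obtain ⟨θ, hcos, hsin⟩ : ∃ θ : ℝ, Real.cos θ = d ∧ Real.sin θ = c := by
      have hz : ‖(⟨d, c⟩ : ℂ)‖ = 1 := by
        rw [← pow_eq_one_iff_of_nonneg (norm_nonneg _) two_ne_zero, Complex.sq_norm,
          Complex.normSq_mk]
        linarith
      have h1 := Complex.norm_mul_cos_arg ⟨d, c⟩
      have h2 := Complex.norm_mul_sin_arg ⟨d, c⟩
      rw [hz, one_mul] at h1 h2
      exact ⟨_, h1, h2⟩
    refine ⟨θ, ?_, fun h4 => hS ?_⟩
    · rw [hcos, hsin]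
      ext x y
      revert x y
      simp only [forall_bits_one]
      simp [rotation, ha, hb, hc, hd]
    · rw [show 4 * θ = 2 * (2 * θ) by ring, Real.sin_two_mul, Real.sin_two_mul, Real.cos_two_mul',
        hcos, hsin] at h4
      have hcases : c = 0 ∨ d = 0 ∨ (d - c) * (d + c) = 0 := by
        have : c * (d * ((d - c) * (d + c))) = 0 := by linear_combination h4 / 4
        simpa only [mul_eq_zero] using this
      rcases hcases with rfl | rfl | h
      · refine ⟨⟨![0], Or.inl ⟨?_, ?_⟩⟩, ⟨![1], Or.inl ⟨?_, ?_⟩⟩⟩ <;> simp <;> linarith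
      · refine ⟨⟨![0], Or.inr ⟨?_, ?_⟩⟩, ⟨![1], Or.inr ⟨?_, ?_⟩⟩⟩ <;> simp <;> linarith
      -- Here `c² = d²`, and `S ^ 2` is a quarter turn.
      · have hprod : (2 * (c * d) - 1) * (2 * (c * d) + 1) = 0 := by
          linear_combination (d * d + c * c + 1) * h21 - ((d - c) * (d + c)) * h
        rcases mul_eq_zero.1 hprod with h' | h'
        · refine ⟨⟨![1], Or.inl ⟨?_, ?_⟩⟩, ⟨![0], Or.inr ⟨?_, ?_⟩⟩⟩ <;> simp <;> linarith
        · refine ⟨⟨![1], Or.inr ⟨?_, ?_⟩⟩, ⟨![0], Or.inl ⟨?_, ?_⟩⟩⟩ <;> simp <;> linarith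
  · refine (hS ⟨⟨![0], Or.inl ⟨?_, ?_⟩⟩, ⟨![1], Or.inl ⟨?_, ?_⟩⟩⟩).elim <;> simp <;> linarith

/-! ### Generating the orthogonal group -/

/-- The action of a two-qubit gate on the Euclidean space of states. -/
noncomputable def toIsometry :
    RealGate 2 ≃* (EuclideanSpace ℝ (Bits 2) ≃ₗᵢ[ℝ] EuclideanSpace ℝ (Bits 2)) :=
  (Unitary.mapEquiv (StarMulEquiv.ofClass (toEuclideanCLM (n := Bits 2) (𝕜 := ℝ)))).toMulEquiv.trans
    Unitary.linearIsometryEquiv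

theorem toIsometry_toLp (g : RealGate 2) (v : Bits 2 → ℝ) :
    toIsometry g (WithLp.toLp 2 v) = WithLp.toLp 2 (g.1 *ᵥ v) := rfl

/-- This CNOT swaps `j` and `k` and fixes `1` and `i`, so it negates exactly the line of `j - k`. -/
theorem toIsometry_flipOne {g : RealGate 2} (hg : g.1 = mapMatrix flipOne) :
    toIsometry g =
      (ℝ ∙ WithLp.toLp 2 (quatCoord (quat 0 0 1 (-1))))ᗮ.reflection := by
  ext x y
  obtain ⟨x, rfl⟩ := (WithLp.equiv 2 _).symm.surjective x
  change (toIsometry g (WithLp.toLp 2 x)).ofLp y = (Submodule.reflection _ (WithLp.toLp 2 x)).ofLp y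
  rw [toIsometry_toLp, hg, Submodule.reflection_orthogonal_apply,
    Submodule.reflection_singleton_apply]
  simp only [EuclideanSpace.norm_eq, EuclideanSpace.inner_eq_star_dotProduct, mulVec, dotProduct, sum_bits_two]
  revert y
  simp only [forall_bits_two]
  simp [quatCoord, mapMatrix, flipOne]
  constructor <;> ring

/-- By Cartan–Dieudonné it suffices to reach each hyperplane reflection, and conjugating the
reflection along `w = j - k` by an isometry taking `w` to a multiple of `q` gives the one along `q`.
-/
theorem eq_top_of_leftMul_mem {C : Subgroup (RealGate 2)}
    (hC : ∀ q : ℍ, ‖q‖ = 1 → ∃ g ∈ C, g.1 = leftMul q) {g₁ : RealGate 2} (hg₁ : g₁ ∈ C)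
    (hg₁' : g₁.1 = mapMatrix flipOne) : C = ⊤ := by
  have htop : C.map toIsometry.toMonoidHom = ⊤ := by
    rw [eq_top_iff, ← LinearIsometryEquiv.reflections_generate, Subgroup.closure_le]
    rintro _ ⟨v, rfl⟩
    obtain ⟨v, rfl⟩ := (WithLp.equiv 2 _).symm.surjective v
    obtain ⟨q, rfl⟩ := quatCoord_surjective v
    change (ℝ ∙ WithLp.toLp 2 (quatCoord q))ᗮ.reflection ∈ C.map toIsometry.toMonoidHom
    rcases eq_or_ne q 0 with rfl | hq
    -- The zero vector is among the given generators; its reflection is the identity.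
    · convert Subgroup.one_mem _
      have : WithLp.toLp 2 (quatCoord 0) = 0 := by
        rw [← zero_smul ℝ (0 : ℍ), quatCoord_smul, zero_smul, WithLp.toLp_zero]
      ext x : 1
      rw [this, Submodule.reflection_eq_self_iff _ |>.2 (by simp)]
      rfl
    · set w : ℍ := quat 0 0 1 (-1) with hw
      have hw0 : w ≠ 0 := fun h => by
        have := congrArg (fun q : ℍ => q.imJ) h
        simp [hw] at this
      set p : ℍ := q * w⁻¹ with hp
      have hp0 : ‖p‖ ≠ 0 := norm_ne_zero_iff.2 (mul_ne_zero hq (inv_ne_zero hw0))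
      obtain ⟨g, hg, hgp⟩ := hC (‖p‖⁻¹ • p) (by
        rw [norm_smul, norm_inv, norm_norm, inv_mul_cancel₀ hp0])
      refine ⟨g * g₁ * g⁻¹, C.mul_mem (C.mul_mem hg hg₁) (C.inv_mem hg), ?_⟩
      change toIsometry (g * g₁ * g⁻¹) = _
      have hgw : toIsometry g (WithLp.toLp 2 (quatCoord w)) =
          ‖p‖⁻¹ • WithLp.toLp 2 (quatCoord q) := by
        rw [toIsometry_toLp, hgp, leftMul_mulVec_quatCoord, smul_mul_assoc, quatCoord_smul, hp,
          mul_assoc, inv_mul_cancel₀ hw0, mul_one, WithLp.toLp_smul]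
      have hspan : (ℝ ∙ WithLp.toLp 2 (quatCoord q))ᗮ =
          (ℝ ∙ WithLp.toLp 2 (quatCoord w))ᗮ.map
            ((toIsometry g).toLinearEquiv : _ →ₗ[ℝ] EuclideanSpace ℝ (Bits 2)) := by
        have h := Submodule.map_orthogonal_equiv (ℝ ∙ WithLp.toLp 2 (quatCoord w)) (toIsometry g)
        refine Eq.trans ?_ h.symm
        rw [Submodule.map_span, Set.image_singleton]
        change _ = (Submodule.span ℝ {toIsometry g (WithLp.toLp 2 (quatCoord w))})ᗮ
        rw [hgw, Submodule.span_singleton_smul_eq (IsUnit.mk0 _ (inv_ne_zero hp0))]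
      rw [map_mul, map_mul, map_inv, toIsometry_flipOne hg₁']
      ext x : 1
      simp only [hspan, Submodule.reflection_map_apply]
      rfl
  rw [eq_top_iff]
  intro g _
  have : toIsometry g ∈ C.map toIsometry.toMonoidHom := htop ▸ Subgroup.mem_top _
  obtain ⟨g', hg', h⟩ := this
  rwa [← toIsometry.injective h]

/-- The quaternions whose left multiplication lies in a subgroup of gates. -/
def quatSubmonoid (C : Subgroup (RealGate 2)) : Submonoid ℍ where
  carrier := {q | ∃ g ∈ C, g.1 = leftMul q}
  mul_mem' := by
    rintro p q ⟨g, hg, hgp⟩ ⟨h, hh, hhq⟩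
    exact ⟨g * h, C.mul_mem hg hh, by rw [leftMul_mul, ← hgp, ← hhq]; rfl⟩
  one_mem' := ⟨1, C.one_mem, by rw [leftMul_one]; rfl⟩

/-- The orthogonal group is closed in the matrices, so `C` is closed there too. -/
theorem isClosed_quatSubmonoid {C : Subgroup (RealGate 2)} (hC : IsClosed (C : Set (RealGate 2))) :
    IsClosed (quatSubmonoid C : Set ℍ) := by
  have h : IsClosed (Subtype.val '' (C : Set (RealGate 2))) :=
    (isClosed_unitary (R := Matrix (Bits 2) (Bits 2) ℝ)).isClosedMap_subtype_val _ hC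
  exact h.preimage continuous_leftMul

theorem star_mem_quatSubmonoid {C : Subgroup (RealGate 2)} :
    ∀ q ∈ quatSubmonoid C, star q ∈ quatSubmonoid C := by
  rintro q ⟨g, hg, hgq⟩
  exact ⟨g⁻¹, C.inv_mem hg, by rw [leftMul_star, ← hgq]; rfl⟩

theorem generatesDense_two (S : RealGate 1) (hS : IsBasisChanging (S ^ 2)) :
    GeneratesDense {⟨2, CNOT⟩, ⟨1, S⟩} 2 := by
  obtain ⟨θ, hrot, hθ⟩ := exists_eq_rotation hS
  set C := (generatedGroup {⟨2, CNOT⟩, ⟨1, S⟩} 2).topologicalClosure with hC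
  have hgate : ∀ g ∈ ({⟨2, CNOT⟩, ⟨1, S⟩} : RealBasis), ∀ A : Fin g.1 ↪ Fin 2,
      g.2.applyTo A ∈ C := fun g hg A =>
    Subgroup.le_topologicalClosure _ (Subgroup.subset_closure ⟨g, hg, A, rfl⟩)
  have h1 : CNOT.applyTo (Function.Embedding.refl (Fin 2)) ∈ C :=
    hgate ⟨2, CNOT⟩ (by simp) _
  have h2 : CNOT.applyTo (Equiv.swap (0 : Fin 2) 1).toEmbedding ∈ C :=
    hgate ⟨2, CNOT⟩ (by simp) _
  have h3 : S.applyTo ⟨fun _ => (1 : Fin 2), fun _ _ _ => Subsingleton.elim _ _⟩ ∈ C :=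
    hgate ⟨1, S⟩ (by simp) _
  have hI : quat (Real.cos θ) (Real.sin θ) 0 0 ∈ quatSubmonoid C := ⟨_, h3, rotation_applyTo hrot rfl⟩
  have hJ : quat (Real.cos θ) 0 (Real.sin θ) 0 ∈ quatSubmonoid C := by
    refine ⟨_, C.mul_mem (C.mul_mem h1 (C.mul_mem (C.mul_mem h2 h3) h2)) h1, ?_⟩
    rw [← conj_leftMul, ← rotation_applyTo (A := ⟨fun _ => 1, fun _ _ _ => Subsingleton.elim _ _⟩) hrot rfl,
      ← CNOT_applyTo_refl, ← CNOT_applyTo_swap]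
    rfl
  have htop := eq_top_of_leftMul_mem (C := C) (fun q hq => mem_of_norm_eq_one
    (isClosed_quatSubmonoid (Subgroup.isClosed_topologicalClosure _)) star_mem_quatSubmonoid
    hθ hI hJ hq) h1 CNOT_applyTo_refl
  rw [GeneratesDense, dense_iff_closure_eq, ← Subgroup.topologicalClosure_coe, ← hC, htop]
  rfl

end RealCircuit

theorem theorem3 (S : RealCircuit.RealGate 1) (hS : RealCircuit.IsBasisChanging (S ^ 2)) :
    RealCircuit.IsComplete {⟨2, RealCircuit.CNOT⟩, ⟨1, S⟩} ∧
      RealCircuit.GeneratesDense {⟨2, RealCircuit.CNOT⟩, ⟨1, S⟩} 2 :=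
  ⟨⟨2, by norm_num, RealCircuit.generatesDense_two S hS⟩, RealCircuit.generatesDense_two S hS⟩
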